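/- Let $d \ge 0$ and $L \ge 1$ be integers, let $S=\{-1,1\}^{\mathbb Z^d}$ carry the product $\sigma$-algebra, and let $|\cdot|$ be the maximum norm on $\mathbb Z^d$. Let $B^L(i)=\{j\in\mathbb Z^d : |i-j|\le L\}$. A pairwise potential is a family $J=\{J(i,j) : i,j\in\mathbb Z^d\}$ of real numbers with $J(i,i)=0$, $J(i,j)=J(j,i)$ and $\sup_i\sum_j|J(i,j)|<\infty$. An Ising model with potential $J$ is a random element $X$ of $S$ such that, for every $i\in\mathbb Z^d$ and $a\in\{-1,1\}$, $$\mathbb P\bigl(X(i)=a \,\big|\, X(j),\, j\ne i\bigr)=\frac{1}{1+\exp\bigl(-2\sum_{j\in\mathbb Z^d}J(i,j)\,a\,X(j)\bigr)}\quad\text{almost surely.}$$ The truncated potential $J^L$ is given by $J^L(i,j)=J(i,j)$ if $|i-j|\le L$ and $J^L(i,j)=0$ otherwise. A coupling between random elements $X$ and $X^L$ of $S$ is a random element $(\tilde X,\tilde X^L)$ of $S\times S$ such that $\tilde X$ has the law of $X$ and $\tilde X^L$ has the law of $X^L$. Theorem. Let $J$ be a pairwise potential with $$\sup_{i\in\mathbb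 Z^d}\sum_{j\in\mathbb Z^d}|J(i,j)|=r<1 .$$ Then Ising models with potential $J$ and with potential $J^L$ exist and, whenever $X$ is an Ising model with potential $J$ and $X^L$ is an Ising model with potential $J^L$, there is a coupling $(\tilde X,\tilde X^L)$ between $X$ and $X^L$ such that, for every $i\in\mathbb Z^d$ simultaneously, $$\mathbb P\bigl(\tilde X(i)\ne\tilde X^L(i)\bigr)\le\frac{1}{1-r}\,\sup_{k\in\mathbb Z^d}\ \sum_{j\in\mathbb Z^d\setminus B^L(k)}|J(k,j)| .$$ -/

import Mathlib

open MeasureTheory ProbabilityTheory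

noncomputable section

/-- The sites of the lattice `ℤ^d`. The norm of Mathlib on this type is the maximum norm. -/
abbrev Site (d : ℕ) : Type := Fin d → ℤ

/-- Spin configurations `S = {-1, 1}^(ℤ^d)`, with the product `σ`-algebra.
The units of `ℤ` are exactly `-1` and `1`. -/
abbrev Config (d : ℕ) : Type := Site d → ℤˣ

/-- The value of a spin, as a real number. -/
def spinVal (a : ℤˣ) : ℝ := ((a : ℤ) : ℝ)

/-- The ball `B^L(i)` of radius `L` around the site `i`, for the maximum norm. -/
def siteBall {d : ℕ} (L : ℕ) (i : Site d) : Set (Site d) := {j | ‖i - j‖ ≤ (L : ℝ)}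

/-- `J` is a pairwise potential: it vanishes on the diagonal, is symmetric, and
`sup_i ∑_j |J(i,j)| < ∞` (each sum converges and the sums are bounded). -/
structure IsPairwisePotential {d : ℕ} (J : Site d → Site d → ℝ) : Prop where
  diag : ∀ i, J i i = 0
  symm : ∀ i j, J i j = J j i
  summable : ∀ i, Summable fun j => |J i j|
  bdd : BddAbove (Set.range fun i => ∑' j, |J i j|)

open Classical in
/-- The truncated potential `J^L`. -/
def truncPotential {d : ℕ} (L : ℕ) (J : Site d → Site d → ℝ) : Site d → Site d → ℝ :=
  fun i j => if j ∈ siteBall L i then J i j else 0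

/-- The `σ`-algebra on configurations generated by the coordinates `x(j)`, `j ≠ i`. -/
abbrev offSite {d : ℕ} (i : Site d) : MeasurableSpace (Config d) :=
  MeasurableSpace.comap (fun (x : Config d) (j : {j : Site d // j ≠ i}) => x j) inferInstance

/-- The single-site conditional probability `1 / (1 + exp (-2 ∑_j J(i,j) a x(j)))`. -/
def localSpec {d : ℕ} (J : Site d → Site d → ℝ) (i : Site d) (a : ℤˣ) (x : Config d) : ℝ :=
  1 / (1 + Real.exp (-2 * ∑' j, J i j * spinVal a * spinVal (x j)))

/-- `μ` is the distribution of an Ising model with potential `J`: for each site `i` and spin `a`,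
`localSpec J i a` is a version of the conditional probability of `x(i) = a` given all the
`x(j)`, `j ≠ i`. -/
def IsIsingLaw {d : ℕ} (J : Site d → Site d → ℝ) (μ : Measure (Config d)) : Prop :=
  ∀ (i : Site d) (a : ℤˣ), μ⟦{x : Config d | x i = a} | offSite i⟧ =ᵐ[μ] localSpec J i a

/-- The random element `X`, defined on a space with probability `P`, is an Ising model with
potential `J`. -/
def IsIsingModel {d : ℕ} {Ω : Type*} [MeasurableSpace Ω] (J : Site d → Site d → ℝ)
    (P : Measure Ω) (X : Ω → Config d) : Prop :=
  Measurable X ∧ IsIsingLaw J (P.map X)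

/-- The random element `Z = (X̃, Ỹ)` of `S × S` (under `Q`) is a coupling between `X` (under `P`)
and `Y` (under `P'`). -/
structure IsCoupling {d : ℕ} {Ω Ω' Ω₀ : Type*} [MeasurableSpace Ω] [MeasurableSpace Ω']
    [MeasurableSpace Ω₀] (P : Measure Ω) (X : Ω → Config d) (P' : Measure Ω') (Y : Ω' → Config d)
    (Q : Measure Ω₀) (Z : Ω₀ → Config d × Config d) : Prop where
  measurable : Measurable Z
  fst : Q.map (fun ω => (Z ω).1) = P.map X
  snd : Q.map (fun ω => (Z ω).2) = P'.map Y

end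

open Filter Topology ENNReal

/-! The Ising laws for `J` are exactly the probability measures fixed by resampling any one spin
from `localSpec` (`isIsingLaw_iff_glauber`). Existence is then compactness: finite-volume Gibbs
measures are fixed by resampling inside the volume, and a weak limit along growing volumes is fixed
by every resampling because `localSpec` is continuous.

For the coupling, write `c` for a bound on all disagreement probabilities of a joining of the two
laws. Resampling site `i` in both configurations, with the optimal coupling of the two spin
distributions, keeps both marginals, leaves the other sites' disagreement probabilities unchanged,
and makes the one at `i` at most `r * c + δ`, where `δ` bounds `∑ |J - J^L|`
(`coupledGlauber_disagree_self_le`). Sweeping over finite sets and passing to a limit gives this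
bound at every site at once (`exists_joining_step`). Iteration contracts to the fixed point `δ / (1
- r)`, and a last limit attains it. -/

instance discreteMeasurableSpace_intUnits : DiscreteMeasurableSpace ℤˣ where
  forall_measurableSet s := ⟨Units.val '' s, .of_discrete, Set.preimage_image_eq _ Units.val_injective⟩

instance borelSpace_intUnits : BorelSpace ℤˣ where
  measurable_eq := by
    rw [borel_eq_top_of_discrete]
    exact top_le_iff.1 fun s _ => MeasurableSet.of_discrete

/-! ### Weak limits, and random moves of a measure. -/

/-- Along some finer filter, a family of probability measures on a compact space converges weakly. -/
theorem exists_weak_limit {E ι : Type*} [TopologicalSpace E] [CompactSpace E] [T2Space E]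
    [MeasurableSpace E] [BorelSpace E] (l : Filter ι) [l.NeBot]
    (m : ι → Measure E) [∀ n, IsProbabilityMeasure (m n)] :
    ∃ μ : Measure E, IsProbabilityMeasure μ ∧ ∃ l' ≤ l, l'.NeBot ∧
      ∀ f : C(E, ℝ), Tendsto (fun n => ∫ x, f x ∂(m n)) l' (𝓝 (∫ x, f x ∂μ)) := by
  let u : ι → ProbabilityMeasure E := fun n => ⟨m n, inferInstance⟩
  obtain ⟨μ, -, hμ⟩ := isCompact_univ.ultrafilter_le_nhds ((Ultrafilter.of l).map u) (by simp)
  -- An ultrafilter replaces a convergent subsequence, so the index may also run over finite volumes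
  -- ordered by inclusion.
  refine ⟨μ, inferInstance, Ultrafilter.of l, Ultrafilter.of_le l, inferInstance, fun f => ?_⟩
  have h : Tendsto u (Ultrafilter.of l) (𝓝 μ) := hμ
  exact ProbabilityMeasure.tendsto_iff_forall_integral_tendsto.1 h
    (BoundedContinuousFunction.mkOfCompact f)

/-- The law obtained from `μ` by moving `x` to `g k x` with weight `w k x`. -/
noncomputable def mixMap {α κ : Type*} [MeasurableSpace α] [Fintype κ] (w : κ → α → ℝ≥0∞)
    (g : κ → α → α) (μ : Measure α) : Measure α :=
  ∑ k, (μ.withDensity (w k)).map (g k)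

theorem lintegral_mixMap {α κ : Type*} [MeasurableSpace α] [Fintype κ] {w : κ → α → ℝ≥0∞}
    {g : κ → α → α} (hw : ∀ k, Measurable (w k)) (hg : ∀ k, Measurable (g k)) (μ : Measure α)
    {f : α → ℝ≥0∞} (hf : Measurable f) :
    ∫⁻ x, f x ∂(mixMap w g μ) = ∫⁻ x, ∑ k, w k x * f (g k x) ∂μ := by
  rw [mixMap, lintegral_finsetSum_measure, lintegral_finsetSum (f := fun k x => w k x * f (g k x)) _
    fun k _ => (hw k).mul (hf.comp (hg k))]
  refine Finset.sum_congr rfl fun k _ => ?_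
  rw [lintegral_map hf (hg k)]
  exact lintegral_withDensity_eq_lintegral_mul _ (hw k) (hf.comp (hg k))

theorem mixMap_apply {α κ : Type*} [MeasurableSpace α] [Fintype κ] {w : κ → α → ℝ≥0∞}
    {g : κ → α → α} (hw : ∀ k, Measurable (w k)) (hg : ∀ k, Measurable (g k)) (μ : Measure α)
    {s : Set α} (hs : MeasurableSet s) :
    mixMap w g μ s = ∫⁻ x, ∑ k, w k x * s.indicator 1 (g k x) ∂μ := by
  rw [← lintegral_indicator_one hs, lintegral_mixMap hw hg μ (measurable_one.indicator hs)]

theorem isProbabilityMeasure_mixMap {α κ : Type*} [MeasurableSpace α] [Fintype κ]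
    {w : κ → α → ℝ≥0∞} {g : κ → α → α} (hw : ∀ k, Measurable (w k)) (hg : ∀ k, Measurable (g k))
    (h1 : ∀ x, ∑ k, w k x = 1) (μ : Measure α) [IsProbabilityMeasure μ] :
    IsProbabilityMeasure (mixMap w g μ) := by
  constructor
  rw [mixMap_apply hw hg μ .univ]
  simp [h1]

theorem integral_mixMap {α κ : Type*} [MeasurableSpace α] [Fintype κ] {w : κ → α → ℝ}
    {g : κ → α → α} (hw : ∀ k, Measurable (w k)) (hw0 : ∀ k x, 0 ≤ w k x) (hw1 : ∀ k x, w k x ≤ 1)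
    (hg : ∀ k, Measurable (g k)) (μ : Measure α) [IsFiniteMeasure μ]
    {f : α → ℝ} (hf : Measurable f) {C : ℝ} (hC : ∀ x, |f x| ≤ C) :
    ∫ x, f x ∂(mixMap (fun k x => ENNReal.ofReal (w k x)) g μ)
      = ∫ x, ∑ k, w k x * f (g k x) ∂μ := by
  have hfin : ∀ k, IsFiniteMeasure (μ.withDensity fun x => ENNReal.ofReal (w k x)) := fun k => by
    refine isFiniteMeasure_withDensity (ne_top_of_le_ne_top (measure_ne_top μ Set.univ) ?_)
    refine (lintegral_mono fun x => ENNReal.ofReal_le_one.2 (hw1 k x)).trans ?_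
    simp
  have hint : ∀ k, Integrable (fun x => w k x * f (g k x)) μ := fun k =>
    Integrable.of_bound ((hw k).mul (hf.comp (hg k))).aestronglyMeasurable C <| ae_of_all _ fun x => by
      rw [Real.norm_eq_abs, abs_mul, abs_of_nonneg (hw0 k x)]
      exact (mul_le_of_le_one_left (abs_nonneg _) (hw1 k x)).trans (hC _)
  rw [mixMap, integral_finsetSum_measure fun k _ => ?_, integral_finsetSum _ fun k _ => hint k]
  · refine Finset.sum_congr rfl fun k _ => ?_
    rw [integral_map (hg k).aemeasurable hf.aestronglyMeasurable,
      integral_withDensity_eq_integral_toReal_smul (hw k).ennreal_ofReal (by simp)]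
    simp [ENNReal.toReal_ofReal (hw0 k _)]
  · have := hfin k
    exact Integrable.of_bound hf.aestronglyMeasurable C (ae_of_all _ hC)

theorem abs_spinVal (a : ℤˣ) : |spinVal a| = 1 := by
  rcases Int.units_eq_one_or a with rfl | rfl <;> simp [spinVal]

theorem continuous_spinVal : Continuous spinVal := continuous_of_discreteTopology

theorem sum_intUnits {M : Type*} [AddCommMonoid M] (f : ℤˣ → M) : ∑ a, f a = f 1 + f (-1) := by
  rw [UnitsInt.univ, Finset.sum_pair (by decide)]

/-! ### Single-site probabilities, and Ising laws as invariant measures. -/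

section LocalSpec

variable {d : ℕ} {J : Site d → Site d → ℝ}

/-- The field `∑_j J(i,j) x(j)` acting on the spin at `i`. -/
noncomputable def localField (J : Site d → Site d → ℝ) (i : Site d) (x : Config d) : ℝ :=
  ∑' j, J i j * spinVal (x j)

theorem localSpec_eq (J : Site d → Site d → ℝ) (i : Site d) (a : ℤˣ) (x : Config d) :
    localSpec J i a x = Real.sigmoid (2 * spinVal a * localField J i x) := by
  rw [localSpec, Real.sigmoid_def, one_div, localField]
  congr 3
  simp_rw [mul_right_comm _ (spinVal a), tsum_mul_right]
  ring

theorem localSpec_nonneg (J : Site d → Site d → ℝ) (i : Site d) (a : ℤˣ) (x : Config d) :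
    0 ≤ localSpec J i a x := by
  rw [localSpec_eq]; exact Real.sigmoid_nonneg _

theorem localSpec_le_one (J : Site d → Site d → ℝ) (i : Site d) (a : ℤˣ) (x : Config d) :
    localSpec J i a x ≤ 1 := by
  rw [localSpec_eq]; exact Real.sigmoid_le_one _

theorem localSpec_neg_one (J : Site d → Site d → ℝ) (i : Site d) (x : Config d) :
    localSpec J i (-1) x = 1 - localSpec J i 1 x := by
  simp only [localSpec_eq, ← Real.sigmoid_neg]
  simp [spinVal]

theorem sum_localSpec (J : Site d → Site d → ℝ) (i : Site d) (x : Config d) :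
    ∑ a, localSpec J i a x = 1 := by
  rw [sum_intUnits, localSpec_neg_one]; ring

theorem localSpec_congr (hJ : IsPairwisePotential J) {i : Site d} {x y : Config d}
    (h : ∀ j, j ≠ i → x j = y j) (a : ℤˣ) : localSpec J i a x = localSpec J i a y := by
  rw [localSpec_eq, localSpec_eq, localField, localField]
  congr 3 with j
  by_cases hj : j = i
  · simp [hj, hJ.diag]
  · rw [h j hj]

/-- `J i i = 0`, so the field at `i` ignores the spin at `i`. -/
theorem localSpec_update (hJ : IsPairwisePotential J) (i : Site d) (a b : ℤˣ) (x : Config d) :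
    localSpec J i a (Function.update x i b) = localSpec J i a x :=
  localSpec_congr hJ (fun _ hj => Function.update_of_ne hj _ _) a

theorem summable_localField (hJ : IsPairwisePotential J) (i : Site d) (x : Config d) :
    Summable fun j => J i j * spinVal (x j) :=
  Summable.of_norm <| by simpa [abs_mul, abs_spinVal] using hJ.summable i

/-- The series for the field is dominated by `∑ |J i j|` uniformly in the configuration. Continuity
is what lets resampling commute with weak limits. -/
theorem continuous_localSpec (hJ : IsPairwisePotential J) (i : Site d) (a : ℤˣ) :
    Continuous (localSpec J i a) := by
  have h : Continuous (localField J i) :=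
    continuous_tsum (fun j => continuous_const.mul (continuous_spinVal.comp (continuous_apply j)))
      (hJ.summable i) fun j x => by simp [abs_spinVal]
  rw [show localSpec J i a = fun x => _ from funext (localSpec_eq J i a)]
  exact continuous_sigmoid.comp (continuous_const.mul h)

theorem measurable_update_site (i : Site d) (a : ℤˣ) :
    Measurable fun x : Config d => Function.update x i a :=
  by
  refine measurable_pi_iff.2 fun j => ?_
  by_cases h : j = i
  · subst h; simp
  · simpa [h] using measurable_pi_apply j

theorem offSite_le (i : Site d) : offSite i ≤ (inferInstance : MeasurableSpace (Config d)) :=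
  Measurable.comap_le (by fun_prop)

/-- A function of the configuration that does not depend on the spin at `i` is measurable with
respect to the other spins. -/
theorem measurable_offSite_comp_update {β : Type*} [MeasurableSpace β] {f : Config d → β}
    (hf : Measurable f) (i : Site d) (a : ℤˣ) :
    Measurable[offSite i] fun x => f (Function.update x i a) := by
  classical
  let e : ({j : Site d // j ≠ i} → ℤˣ) → Config d := fun y j => if h : j ≠ i then y ⟨j, h⟩ else a
  have he : Measurable e := by
    refine measurable_pi_iff.2 fun j => ?_
    by_cases h : j = i
    · subst h; simp [e]
    · simpa [e, h] using measurable_pi_apply _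
  have : (fun x => f (Function.update x i a))
      = (f ∘ e) ∘ fun (x : Config d) (j : {j : Site d // j ≠ i}) => x j := by
    funext x
    simp only [Function.comp]
    congr 1 with j
    by_cases h : j = i
    · subst h; simp [e]
    · simp [e, h]
  rw [this]
  exact (hf.comp he).comp (comap_measurable _)

theorem update_mem_iff_of_offSite {i : Site d} {s : Set (Config d)} (hs : MeasurableSet[offSite i] s)
    (a : ℤˣ) (x : Config d) : Function.update x i a ∈ s ↔ x ∈ s := by
  obtain ⟨t, -, rfl⟩ := hs
  simp only [Set.mem_preimage]
  congr! 2 with j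
  exact Function.update_of_ne j.2 _ _

/-- The law of `x` after resampling the spin at `i` with the single-site probabilities. -/
noncomputable def glauber (J : Site d → Site d → ℝ) (i : Site d) (μ : Measure (Config d)) :
    Measure (Config d) :=
  mixMap (fun a x => ENNReal.ofReal (localSpec J i a x)) (fun a x => Function.update x i a) μ

theorem measurable_localSpec (hJ : IsPairwisePotential J) (i : Site d) (a : ℤˣ) :
    Measurable (localSpec J i a) := (continuous_localSpec hJ i a).measurable

theorem sum_ofReal_localSpec (J : Site d → Site d → ℝ) (i : Site d) (x : Config d) :
    ∑ a, ENNReal.ofReal (localSpec J i a x) = 1 := by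
  rw [← ENNReal.ofReal_sum_of_nonneg fun a _ => localSpec_nonneg J i a x, sum_localSpec,
    ENNReal.ofReal_one]

theorem isProbabilityMeasure_glauber (hJ : IsPairwisePotential J) (i : Site d)
    (μ : Measure (Config d)) [IsProbabilityMeasure μ] : IsProbabilityMeasure (glauber J i μ) :=
  isProbabilityMeasure_mixMap (fun a => (measurable_localSpec hJ i a).ennreal_ofReal)
    (measurable_update_site i) (sum_ofReal_localSpec J i) μ

theorem glauber_apply (hJ : IsPairwisePotential J) (i : Site d)
    (μ : Measure (Config d)) {s : Set (Config d)} (hs : MeasurableSet s) :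
    glauber J i μ s
      = ∑ a, ∫⁻ x in {x | Function.update x i a ∈ s}, ENNReal.ofReal (localSpec J i a x) ∂μ := by
  rw [glauber, mixMap_apply (fun a => (measurable_localSpec hJ i a).ennreal_ofReal)
    (measurable_update_site i) μ hs, lintegral_finsetSum]
  · refine Finset.sum_congr rfl fun a _ => ?_
    rw [← lintegral_indicator (show MeasurableSet {x : Config d | Function.update x i a ∈ s} from
      measurable_update_site i a hs)]
    refine lintegral_congr fun x => ?_
    by_cases h : Function.update x i a ∈ s <;> simp [h]
  · exact fun a _ => (measurable_localSpec hJ i a).ennreal_ofReal.mul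
      ((measurable_one.indicator hs).comp (measurable_update_site i a))

theorem lintegral_localSpec (hJ : IsPairwisePotential J) (i : Site d) (a : ℤˣ)
    (μ : Measure (Config d)) [IsFiniteMeasure μ] :
    ∫⁻ x, ENNReal.ofReal (localSpec J i a x) ∂μ = ENNReal.ofReal (∫ x, localSpec J i a x ∂μ) := by
  rw [ofReal_integral_eq_lintegral_ofReal _ (ae_of_all _ (localSpec_nonneg J i a))]
  exact Integrable.of_bound (measurable_localSpec hJ i a).aestronglyMeasurable 1
    (ae_of_all _ fun x => by
      rw [Real.norm_of_nonneg (localSpec_nonneg J i a x)]; exact localSpec_le_one J i a x)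

theorem measurableSet_spin_eq (i : Site d) (a : ℤˣ) : MeasurableSet {x : Config d | x i = a} :=
  (measurable_pi_apply i : Measurable fun x : Config d => x i)
    (MeasurableSet.of_discrete (s := {a}))

/-- Ising laws are the laws left invariant by each single-site resampling. -/
theorem isIsingLaw_iff_glauber (hJ : IsPairwisePotential J) {μ : Measure (Config d)}
    [IsProbabilityMeasure μ] : IsIsingLaw J μ ↔ ∀ i, glauber J i μ = μ := by
  constructor
  · intro h i
    ext s hs
    rw [glauber_apply hJ i μ hs]
    have key : ∀ a : ℤˣ, ∫⁻ x in {x | Function.update x i a ∈ s},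
        ENNReal.ofReal (localSpec J i a x) ∂μ = μ (s ∩ {x | x i = a}) := fun a => by
      -- This event depends only on the spins off `i`, so the conditional probability can be
      -- integrated over it; on `{x i = a}` it coincides with `s`.
      have hB : MeasurableSet[offSite i] {x : Config d | Function.update x i a ∈ s} :=
        measurable_offSite_comp_update measurable_id i a hs
      rw [lintegral_localSpec hJ, ← setIntegral_congr_ae (g := localSpec J i a)
        (offSite_le i _ hB) ((h i a).mono fun x hx _ => hx),
        setIntegral_condExp (offSite_le i) ((integrable_const 1).indicator
          (measurableSet_spin_eq i a)) hB, setIntegral_indicator (measurableSet_spin_eq i a)]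
      rw [setIntegral_const, smul_eq_mul, mul_one, ofReal_measureReal]
      congr 1
      refine Set.ext fun x => ?_
      simp only [Set.mem_inter_iff, Set.mem_ofPred_eq, and_congr_left_iff]
      rintro rfl
      simp
    simp_rw [key, sum_intUnits]
    rw [← measure_union _ (hs.inter (measurableSet_spin_eq i _))]
    · congr 1
      ext x
      rcases Int.units_eq_one_or (x i) with h | h <;> simp [h]
    · refine Set.disjoint_left.2 fun x hx hx' => ?_
      have := hx.2.symm.trans hx'.2
      exact absurd this (by decide)
  · intro h i a
    refine (ae_eq_condExp_of_forall_setIntegral_eq (offSite_le i)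
      ((integrable_const 1).indicator (measurableSet_spin_eq i a)) (fun s _ _ => ?_)
      (fun s hs _ => ?_) ?_).symm
    · refine Integrable.integrableOn (Integrable.of_bound
        (measurable_localSpec hJ i a).aestronglyMeasurable 1 (ae_of_all _ fun x => ?_))
      rw [Real.norm_of_nonneg (localSpec_nonneg J i a x)]; exact localSpec_le_one J i a x
    · have hs' := offSite_le i _ hs
      rw [setIntegral_indicator (measurableSet_spin_eq i a)]
      -- Invariance is tested on `s ∩ {x i = a}`. Membership in `s` does not see the spin at `i`, so
      -- only the resampled value `a` contributes, and it contributes the integral over all of `s`.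
      have h2 := glauber_apply hJ i μ (hs'.inter (measurableSet_spin_eq i a))
      rw [h i, Finset.sum_eq_single a] at h2
      · have hset : {x : Config d | Function.update x i a ∈ s ∩ {x | x i = a}} = s := by
          ext x; simp [update_mem_iff_of_offSite hs]
        rw [hset, lintegral_localSpec hJ] at h2
        rw [setIntegral_const, smul_eq_mul, mul_one, measureReal_def, h2]
        rw [ENNReal.toReal_ofReal (integral_nonneg (localSpec_nonneg J i a))]
      · intro b _ hb
        have hset : {x : Config d | Function.update x i b ∈ s ∩ {x | x i = a}} = ∅ := by
          ext x; simp [hb]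
        rw [hset, Measure.restrict_empty, lintegral_zero_measure]
      · exact fun h => absurd (Finset.mem_univ a) h
    · refine StronglyMeasurable.aestronglyMeasurable (Measurable.stronglyMeasurable ?_)
      have := measurable_offSite_comp_update (measurable_localSpec hJ i a) i 1
      simpa only [localSpec_update hJ] using this

end LocalSpec

/-- Only coordinate `i` of the quadratic form is shifted: the `t * t` term carries `J i i = 0`, and
the two cross terms agree by symmetry. -/
theorem sum_sum_mul_add_single {ι : Type*} [DecidableEq ι] (s : Finset ι) (J : ι → ι → ℝ)
    (hJ : ∀ i j, J i j = J j i) {i : ι} (hi : i ∈ s) (hii : J i i = 0) (v : ι → ℝ) (t : ℝ) :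
    ∑ k ∈ s, ∑ j ∈ s, J k j * (v k + if k = i then t else 0) * (v j + if j = i then t else 0)
      = ∑ k ∈ s, ∑ j ∈ s, J k j * v k * v j + 2 * t * ∑ j ∈ s, J i j * v j := by
  have h : ∀ k j, J k j * (v k + if k = i then t else 0) * (v j + if j = i then t else 0)
      = J k j * v k * v j + (if j = i then t * (J k j * v k) else 0)
        + (if k = i then t * (J k j * v j) else 0)
        + (if j = i then if k = i then t * t * J k j else 0 else 0) := fun k j => by
    split_ifs <;> ring
  simp only [h, Finset.sum_add_distrib, Finset.sum_ite_eq', hi, if_true, hii]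
  rw [Finset.sum_comm (f := fun k j => if k = i then t * (J k j * v j) else 0)]
  simp only [Finset.sum_ite_eq', hi, if_true, ← Finset.mul_sum, hJ _ i]
  ring

/-! ### Existence of Ising laws by finite-volume approximation. -/

section Existence

variable {d : ℕ} {J : Site d → Site d → ℝ}

/-- The energy of a configuration in the finite volume `Λ` with all spins outside equal to `1`. -/
noncomputable def energy (J : Site d → Site d → ℝ) (Λ : Finset (Site d)) (x : Config d) : ℝ :=
  1 / 2 * ∑ k ∈ Λ, ∑ j ∈ Λ, J k j * spinVal (x k) * spinVal (x j)
    + ∑ k ∈ Λ, (∑' j : ↥((Λ : Set (Site d))ᶜ), J k j) * spinVal (x k)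

/-- The factor `1 / 2` in the energy cancels the doubled cross term, and the outside spins, all `1`,
supply the rest of the field at `i`. -/
theorem energy_update (hJ : IsPairwisePotential J) {Λ : Finset (Site d)} {i : Site d} (hi : i ∈ Λ)
    {x : Config d} (hx : ∀ j ∉ Λ, x j = 1) (a : ℤˣ) :
    energy J Λ (Function.update x i a)
      = energy J Λ x + (spinVal a - spinVal (x i)) * localField J i x := by
  have hu : ∀ k, spinVal (Function.update x i a k)
      = spinVal (x k) + if k = i then spinVal a - spinVal (x i) else 0 := fun k => by
    by_cases h : k = i
    · subst h; simp
    · simp [h]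
  have hf : localField J i x
      = ∑ j ∈ Λ, J i j * spinVal (x j) + ∑' j : ↥((Λ : Set (Site d))ᶜ), J i j := by
    rw [localField, ← (summable_localField hJ i x).sum_add_tsum_compl (s := Λ)]
    congr 2 with j
    rw [hx j j.2]
    simp [spinVal]
  simp only [energy, hu]
  rw [sum_sum_mul_add_single Λ J hJ.symm hi (hJ.diag i) (fun k => spinVal (x k)), hf]
  simp only [mul_add, Finset.sum_add_distrib, mul_ite, mul_zero, Finset.sum_ite_eq', hi, if_true]
  ring

/-- Detailed balance of the Gibbs weights under resampling at `i`. When the spin flips, it reduces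
to `σ(u) = exp u * σ(-u)` for the logistic function. -/
theorem exp_energy_mul_localSpec (hJ : IsPairwisePotential J) {Λ : Finset (Site d)} {i : Site d}
    (hi : i ∈ Λ) {x : Config d} (hx : ∀ j ∉ Λ, x j = 1) (a : ℤˣ) :
    Real.exp (energy J Λ x) * localSpec J i a x
      = Real.exp (energy J Λ (Function.update x i a)) * localSpec J i (x i) x := by
  have key : ∀ u, Real.sigmoid u = Real.exp u * Real.sigmoid (-u) := fun u => by
    simpa [mul_comm] using (Real.sigmoid_mul_rexp_neg (-u)).symm
  rw [energy_update hJ hi hx, Real.exp_add, mul_assoc]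
  congr 1
  simp only [localSpec_eq]
  generalize localField J i x = h
  rcases Int.units_eq_one_or a with rfl | rfl <;> rcases Int.units_eq_one_or (x i) with hb | hb <;>
    simp only [hb, spinVal, sub_self, zero_mul, Real.exp_zero, one_mul]
  · rw [key]
    congr 2 <;> push_cast <;> ring
  · rw [key]
    congr 2 <;> push_cast <;> ring

/-- The finite-volume Gibbs measure is invariant under resampling inside the volume. -/
theorem exists_glauber_invariant_finset (hJ : IsPairwisePotential J) (Λ : Finset (Site d)) :
    ∃ m : Measure (Config d), IsProbabilityMeasure m ∧ ∀ i ∈ Λ, glauber J i m = m := by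
  classical
  obtain ⟨F, hF⟩ : ∃ F : Finset (Config d), ∀ x, x ∈ F ↔ ∀ j ∉ Λ, x j = 1 := by
    refine ⟨Finset.univ.image fun (σ : Λ → ℤˣ) j => if h : j ∈ Λ then σ ⟨j, h⟩ else 1, fun x => ?_⟩
    simp only [Finset.mem_image, Finset.mem_univ, true_and]
    constructor
    · rintro ⟨σ, rfl⟩ j hj
      simp [hj]
    · refine fun h => ⟨fun j => x j, funext fun j => ?_⟩
      by_cases hj : j ∈ Λ
      · simp [hj]
      · simp [hj, h j hj]
  set Z : ℝ := ∑ x ∈ F, Real.exp (energy J Λ x) with hZ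
  have hZ0 : 0 < Z := Finset.sum_pos (fun x _ => Real.exp_pos _) ⟨1, (hF 1).2 fun _ _ => rfl⟩
  let w : Config d → ℝ≥0∞ := fun x => ENNReal.ofReal (Real.exp (energy J Λ x) / Z)
  refine ⟨∑ x ∈ F, w x • Measure.dirac x, ⟨?_⟩, fun i hi => ?_⟩
  · simp only [Measure.coe_finsetSum, Finset.sum_apply, Measure.smul_apply, measure_univ,
      smul_eq_mul, mul_one, w]
    rw [← ENNReal.ofReal_sum_of_nonneg fun x _ => by positivity, ← Finset.sum_div, ← hZ,
      div_self hZ0.ne', ENNReal.ofReal_one]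
  · have hp := fun a => (measurable_localSpec hJ i a).ennreal_ofReal
    have hw : ∀ x ∈ F, ∀ a, w x * ENNReal.ofReal (localSpec J i a x)
        = w (Function.update x i a) * ENNReal.ofReal (localSpec J i (x i) x) := fun x hx a => by
      rw [← ENNReal.ofReal_mul (by positivity), ← ENNReal.ofReal_mul (by positivity), div_mul_eq_mul_div,
        exp_energy_mul_localSpec hJ hi ((hF x).1 hx), div_mul_eq_mul_div]
    have hupd : ∀ x ∈ F, ∀ a, Function.update x i a ∈ F := fun x hx a => (hF _).2 fun j hj => by
      rw [Function.update_of_ne (by rintro rfl; exact hj hi), (hF x).1 hx j hj]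
    ext s hs
    rw [glauber, mixMap_apply hp (measurable_update_site i) _ hs]
    have hmeas : Measurable fun x : Config d => ∑ a, ENNReal.ofReal (localSpec J i a x)
        * s.indicator (1 : Config d → ℝ≥0∞) (Function.update x i a) :=
      Finset.measurable_fun_sum _ fun a _ =>
        (hp a).mul ((measurable_one.indicator hs).comp (measurable_update_site i a))
    simp only [lintegral_finsetSum_measure, lintegral_smul_measure, lintegral_dirac' _ hmeas,
      Measure.coe_finsetSum, Finset.sum_apply, Measure.smul_apply, Measure.dirac_apply' _ hs,
      smul_eq_mul]
    calc ∑ x ∈ F, w x * ∑ a, ENNReal.ofReal (localSpec J i a x)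
            * s.indicator (1 : Config d → ℝ≥0∞) (Function.update x i a)
        = ∑ z ∈ F ×ˢ (Finset.univ : Finset ℤˣ), w (Function.update z.1 i z.2)
            * ENNReal.ofReal (localSpec J i (z.1 i) (Function.update z.1 i z.2))
            * s.indicator (1 : Config d → ℝ≥0∞) (Function.update z.1 i z.2) := by
          rw [Finset.sum_product]
          refine Finset.sum_congr rfl fun x hx => ?_
          rw [Finset.mul_sum]
          refine Finset.sum_congr rfl fun a _ => ?_
          rw [← mul_assoc, hw x hx, localSpec_update hJ]
      _ = ∑ z ∈ F ×ˢ (Finset.univ : Finset ℤˣ), w z.1 * ENNReal.ofReal (localSpec J i z.2 z.1)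
            * s.indicator (1 : Config d → ℝ≥0∞) z.1 := by
          -- Exchanging the old and new spins at `i` is an involution on pairs (configuration, new
          -- spin); with detailed balance it turns the resampled sum into the original one.
          refine Finset.sum_nbij' (fun z => (Function.update z.1 i z.2, z.1 i))
            (fun z => (Function.update z.1 i z.2, z.1 i)) ?_ ?_ ?_ ?_ ?_
          · intro z hz
            simp only [Finset.mem_product, Finset.mem_univ, and_true] at hz ⊢
            exact hupd _ hz _
          · intro z hz
            simp only [Finset.mem_product, Finset.mem_univ, and_true] at hz ⊢
            exact hupd _ hz _
          · intro z _; simp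
          · intro z _; simp
          · intro z _; simp
      _ = _ := by
          rw [Finset.sum_product]
          refine Finset.sum_congr rfl fun x hx => ?_
          simp only [← Finset.sum_mul, ← Finset.mul_sum, sum_ofReal_localSpec, mul_one]

theorem measure_ext_of_continuousMap {E : Type*} [TopologicalSpace E] [CompactSpace E]
    [MeasurableSpace E] [BorelSpace E] [HasOuterApproxClosed E] {μ ν : Measure E}
    [IsFiniteMeasure μ] [IsFiniteMeasure ν] (h : ∀ f : C(E, ℝ), ∫ x, f x ∂μ = ∫ x, f x ∂ν) :
    μ = ν :=
  ext_of_forall_integral_eq_of_IsFiniteMeasure fun f => h f.toContinuousMap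

/-- Each fixed site lies in all large enough volumes, so the two integrals that express invariance
there agree eventually and have the same limit. -/
theorem exists_isIsingLaw (hJ : IsPairwisePotential J) :
    ∃ μ : Measure (Config d), IsProbabilityMeasure μ ∧ IsIsingLaw J μ := by
  choose m hm hinv using exists_glauber_invariant_finset hJ
  obtain ⟨μ, hμ, l, hl, hl0, hlim⟩ := exists_weak_limit atTop m
  refine ⟨μ, hμ, (isIsingLaw_iff_glauber hJ).2 fun i => ?_⟩
  have := isProbabilityMeasure_glauber hJ i μ
  refine measure_ext_of_continuousMap fun f => ?_
  have hint : ∀ (ν : Measure (Config d)) [IsFiniteMeasure ν], ∫ x, f x ∂(glauber J i ν)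
      = ∫ x, ∑ a, localSpec J i a x * f (Function.update x i a) ∂ν := fun ν _ =>
    integral_mixMap (measurable_localSpec hJ i) (localSpec_nonneg J i) (localSpec_le_one J i)
      (measurable_update_site i) ν f.continuous.measurable (C := ‖f‖) f.norm_coe_le_norm
  let g : C(Config d, ℝ) := ⟨fun x => ∑ a, localSpec J i a x * f (Function.update x i a),
    continuous_finsetSum _ fun a _ => (continuous_localSpec hJ i a).mul
      (f.continuous.comp (continuous_id.update i continuous_const))⟩
  rw [hint μ]
  refine tendsto_nhds_unique_of_eventuallyEq (hlim g) (hlim f) (hl ?_)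
  filter_upwards [eventually_ge_atTop {i}] with Λ hΛ
  change ∫ x, ∑ a, localSpec J i a x * f (Function.update x i a) ∂(m Λ) = _
  rw [← hint, hinv Λ i (hΛ (Finset.mem_singleton_self i))]

end Existence

/-! ### Optimal coupling of two spins, and the Lipschitz constant of the logistic function. -/

/-- The optimal coupling of two probability vectors on `{-1, 1}`. -/
noncomputable def optimalWeight (p q : ℤˣ → ℝ) (a b : ℤˣ) : ℝ :=
  if a = b then min (p a) (q a) else p a - min (p a) (q a)

theorem optimalWeight_nonneg {p q : ℤˣ → ℝ} (hp : ∀ a, 0 ≤ p a) (hq : ∀ a, 0 ≤ q a) (a b : ℤˣ) :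
    0 ≤ optimalWeight p q a b := by
  rw [optimalWeight]
  split_ifs
  · exact le_min (hp a) (hq a)
  · exact sub_nonneg.2 (min_le_left _ _)

theorem sum_optimalWeight_right (p q : ℤˣ → ℝ) (a : ℤˣ) : ∑ b, optimalWeight p q a b = p a := by
  rw [sum_intUnits]
  rcases Int.units_eq_one_or a with rfl | rfl <;> simp [optimalWeight]

theorem sum_optimalWeight_left {p q : ℤˣ → ℝ} (hp : ∑ a, p a = 1) (hq : ∑ a, q a = 1) (b : ℤˣ) :
    ∑ a, optimalWeight p q a b = q b := by
  rw [sum_intUnits] at *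
  rcases Int.units_eq_one_or b with rfl | rfl
  · simp only [optimalWeight, if_true, show ((-1 : ℤˣ) = 1) = False by simp, if_false]
    rcases le_total (p 1) (q 1) with h | h
    · rw [min_eq_left h, min_eq_right (by linarith)]; linarith
    · rw [min_eq_right h, min_eq_left (by linarith)]; linarith
  · simp only [optimalWeight, if_true, show ((1 : ℤˣ) = -1) = False by simp, if_false]
    rcases le_total (p 1) (q 1) with h | h
    · rw [min_eq_left h, min_eq_right (by linarith)]; linarith
    · rw [min_eq_right h, min_eq_left (by linarith)]; linarith

/-- The mass off the diagonal is the total variation distance, the least that any coupling can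
achieve. -/
theorem optimalWeight_off_diag {p q : ℤˣ → ℝ} (hp : ∑ a, p a = 1) (hq : ∑ a, q a = 1) :
    optimalWeight p q 1 (-1) + optimalWeight p q (-1) 1 = |p 1 - q 1| := by
  rw [sum_intUnits] at *
  simp only [optimalWeight, show ((1 : ℤˣ) = -1) = False by simp,
    show ((-1 : ℤˣ) = 1) = False by simp, if_false]
  rcases le_total (p 1) (q 1) with h | h
  · rw [min_eq_left h, min_eq_right (by linarith), abs_of_nonpos (by linarith)]; linarith
  · rw [min_eq_right h, min_eq_left (by linarith), abs_of_nonneg (by linarith)]; linarith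

/-- The derivative `σ (1 - σ)` is at most `1 / 4`. -/
theorem abs_sigmoid_sub_le (u v : ℝ) : |Real.sigmoid u - Real.sigmoid v| ≤ 1 / 4 * |u - v| := by
  have := Convex.norm_image_sub_le_of_norm_deriv_le (f := Real.sigmoid) (s := Set.univ) (C := 1 / 4)
    (x := v) (y := u) (fun x _ => differentiable_sigmoid.differentiableAt) (fun x _ => ?_)
    convex_univ (Set.mem_univ _) (Set.mem_univ _)
  · simpa using this
  · rw [Real.deriv_sigmoid, Real.norm_of_nonneg (mul_nonneg (Real.sigmoid_nonneg x)
      (sub_nonneg.2 (Real.sigmoid_le_one x)))]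
    nlinarith [sq_nonneg (Real.sigmoid x - 1 / 2)]

/-! ### Coupled resampling and the contraction of disagreement. -/

section Coupling

variable {d : ℕ} {J J' : Site d → Site d → ℝ}

/-- The pairs of configurations that disagree at the site `i`. -/
def disagree (i : Site d) : Set (Config d × Config d) := {z | z.1 i ≠ z.2 i}

theorem isClopen_disagree (i : Site d) : IsClopen (disagree i) := by
  have h : Continuous fun z : Config d × Config d => (z.1 i, z.2 i) := by fun_prop
  exact (isClopen_discrete {c : ℤˣ × ℤˣ | c.1 ≠ c.2}).preimage h

theorem measurableSet_disagree (i : Site d) : MeasurableSet (disagree i) :=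
  (isClopen_disagree i).isOpen.measurableSet

/-- The law of a pair of configurations after resampling the spins at `i` of both with the optimal
coupling of the two single-site distributions. -/
noncomputable def coupledGlauber (J J' : Site d → Site d → ℝ) (i : Site d)
    (π : Measure (Config d × Config d)) : Measure (Config d × Config d) :=
  mixMap (fun (k : ℤˣ × ℤˣ) z => ENNReal.ofReal (optimalWeight (localSpec J i · z.1)
    (localSpec J' i · z.2) k.1 k.2))
    (fun k z => (Function.update z.1 i k.1, Function.update z.2 i k.2)) π

theorem measurable_coupledGlauber_weight (hJ : IsPairwisePotential J) (hJ' : IsPairwisePotential J')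
    (i : Site d) (k : ℤˣ × ℤˣ) : Measurable fun z : Config d × Config d =>
      ENNReal.ofReal (optimalWeight (localSpec J i · z.1) (localSpec J' i · z.2) k.1 k.2) := by
  have h1 := fun a => (measurable_localSpec hJ i a).comp (measurable_fst : Measurable (Prod.fst : Config d × Config d → _))
  have h2 := fun a => (measurable_localSpec hJ' i a).comp (measurable_snd : Measurable (Prod.snd : Config d × Config d → _))
  refine Measurable.ennreal_ofReal ?_
  simp only [optimalWeight]
  split_ifs
  · exact (h1 _).min (h2 _)
  · exact (h1 _).sub ((h1 _).min (h2 _))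

theorem measurable_update_pair (i : Site d) (k : ℤˣ × ℤˣ) : Measurable fun z : Config d × Config d =>
    (Function.update z.1 i k.1, Function.update z.2 i k.2) :=
  ((measurable_update_site i k.1).comp measurable_fst).prodMk
    ((measurable_update_site i k.2).comp measurable_snd)

theorem sum_ofReal_weight_right (J J' : Site d → Site d → ℝ) (i : Site d) (x y : Config d) (a : ℤˣ) :
    ∑ b, ENNReal.ofReal (optimalWeight (localSpec J i · x) (localSpec J' i · y) a b)
      = ENNReal.ofReal (localSpec J i a x) := by
  rw [← ENNReal.ofReal_sum_of_nonneg fun b _ => optimalWeight_nonneg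
    (localSpec_nonneg J i · x) (localSpec_nonneg J' i · y) a b, sum_optimalWeight_right]

theorem sum_ofReal_weight_left (J J' : Site d → Site d → ℝ) (i : Site d) (x y : Config d) (b : ℤˣ) :
    ∑ a, ENNReal.ofReal (optimalWeight (localSpec J i · x) (localSpec J' i · y) a b)
      = ENNReal.ofReal (localSpec J' i b y) := by
  rw [← ENNReal.ofReal_sum_of_nonneg fun a _ => optimalWeight_nonneg
    (localSpec_nonneg J i · x) (localSpec_nonneg J' i · y) a b,
    sum_optimalWeight_left (sum_localSpec J i x) (sum_localSpec J' i y)]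

theorem coupledGlauber_apply (hJ : IsPairwisePotential J) (hJ' : IsPairwisePotential J') (i : Site d)
    (π : Measure (Config d × Config d)) {s : Set (Config d × Config d)} (hs : MeasurableSet s) :
    coupledGlauber J J' i π s = ∫⁻ z, ∑ a, ∑ b, ENNReal.ofReal (optimalWeight (localSpec J i · z.1)
      (localSpec J' i · z.2) a b) * s.indicator 1 (Function.update z.1 i a, Function.update z.2 i b)
        ∂π := by
  rw [coupledGlauber, mixMap_apply (measurable_coupledGlauber_weight hJ hJ' i)
    (measurable_update_pair i) π hs]
  simp only [Fintype.sum_prod_type]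

theorem map_fst_coupledGlauber (hJ : IsPairwisePotential J) (hJ' : IsPairwisePotential J')
    (i : Site d) (π : Measure (Config d × Config d)) :
    (coupledGlauber J J' i π).map Prod.fst = glauber J i (π.map Prod.fst) := by
  have hp := fun a => (measurable_localSpec hJ i a).ennreal_ofReal
  ext s hs
  rw [Measure.map_apply measurable_fst hs, coupledGlauber_apply hJ hJ' i π (measurable_fst hs),
    glauber, mixMap_apply hp (measurable_update_site i) _ hs, lintegral_map _ measurable_fst]
  · refine lintegral_congr fun z => Finset.sum_congr rfl fun a _ => ?_
    rw [← sum_ofReal_weight_right J J' i z.1 z.2 a, Finset.sum_mul]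
    rfl
  · exact Finset.measurable_fun_sum _ fun a _ =>
      (hp a).mul ((measurable_one.indicator hs).comp (measurable_update_site i a))

theorem map_snd_coupledGlauber (hJ : IsPairwisePotential J) (hJ' : IsPairwisePotential J')
    (i : Site d) (π : Measure (Config d × Config d)) :
    (coupledGlauber J J' i π).map Prod.snd = glauber J' i (π.map Prod.snd) := by
  have hp := fun a => (measurable_localSpec hJ' i a).ennreal_ofReal
  ext s hs
  rw [Measure.map_apply measurable_snd hs, coupledGlauber_apply hJ hJ' i π (measurable_snd hs),
    glauber, mixMap_apply hp (measurable_update_site i) _ hs, lintegral_map _ measurable_snd]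
  · refine lintegral_congr fun z => ?_
    rw [Finset.sum_comm]
    refine Finset.sum_congr rfl fun b _ => ?_
    rw [← sum_ofReal_weight_left J J' i z.1 z.2 b, Finset.sum_mul]
    rfl
  · exact Finset.measurable_fun_sum _ fun a _ =>
      (hp a).mul ((measurable_one.indicator hs).comp (measurable_update_site i a))

/-- The move does not touch site `j`, and its weights sum to one. -/
theorem coupledGlauber_disagree_of_ne (hJ : IsPairwisePotential J) (hJ' : IsPairwisePotential J')
    {i j : Site d} (hj : j ≠ i) (π : Measure (Config d × Config d)) :
    coupledGlauber J J' i π (disagree j) = π (disagree j) := by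
  rw [coupledGlauber_apply hJ hJ' i π (measurableSet_disagree j),
    ← lintegral_indicator_one (measurableSet_disagree j)]
  refine lintegral_congr fun z => ?_
  have h : ∀ a b, (disagree j).indicator (1 : Config d × Config d → ℝ≥0∞)
      (Function.update z.1 i a, Function.update z.2 i b) = (disagree j).indicator 1 z :=
    fun a b => by simp [Set.indicator_apply, disagree, Function.update_of_ne hj]
  simp only [h, ← Finset.sum_mul, sum_ofReal_weight_right, sum_ofReal_localSpec, one_mul]

theorem coupledGlauber_disagree_self (hJ : IsPairwisePotential J) (hJ' : IsPairwisePotential J')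
    (i : Site d) (π : Measure (Config d × Config d)) :
    coupledGlauber J J' i π (disagree i)
      = ∫⁻ z, ENNReal.ofReal |localSpec J i 1 z.1 - localSpec J' i 1 z.2| ∂π := by
  rw [coupledGlauber_apply hJ hJ' i π (measurableSet_disagree i)]
  refine lintegral_congr fun z => ?_
  rw [← optimalWeight_off_diag (sum_localSpec J i z.1) (sum_localSpec J' i z.2),
    ENNReal.ofReal_add (optimalWeight_nonneg (localSpec_nonneg J i · z.1)
      (localSpec_nonneg J' i · z.2) _ _) (optimalWeight_nonneg (localSpec_nonneg J i · z.1)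
      (localSpec_nonneg J' i · z.2) _ _)]
  simp [Set.indicator_apply, disagree]

/-- The constants multiply to one: `1 / 4` from the logistic function, `2` from its argument, `2`
from the difference of opposite spins. This is why the threshold is `r < 1`. The potential
difference comes with a factor `1 / 2`, which is given away. -/
theorem abs_localSpec_sub_le (hJ : IsPairwisePotential J) (hJ' : IsPairwisePotential J') (i : Site d)
    (z : Config d × Config d) : |localSpec J i 1 z.1 - localSpec J' i 1 z.2|
      ≤ ∑' j, |J' i j| * (disagree j).indicator 1 z + ∑' j, |J i j - J' i j| := by
  have hs1 : Summable fun j => |J' i j| * (disagree j).indicator (1 : Config d × Config d → ℝ) z :=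
    (hJ'.summable i).of_nonneg_of_le
      (fun j => mul_nonneg (abs_nonneg _) (Set.indicator_nonneg (fun _ _ => zero_le_one) _))
      fun j => mul_le_of_le_one_right (abs_nonneg _)
        (Set.indicator_le_self' (fun _ _ => zero_le_one) _)
  have hs2 : Summable fun j => |J i j - J' i j| :=
    ((hJ.summable i).of_abs.sub (hJ'.summable i).of_abs).abs
  have hterm : ∀ j, |J i j * spinVal (z.1 j) - J' i j * spinVal (z.2 j)|
      ≤ 2 * (|J' i j| * (disagree j).indicator 1 z) + |J i j - J' i j| := fun j => by
    -- The change of spins is charged to `J'` alone, so the contraction rate involves only the row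
    -- sums of `J'`.
    have e : J i j * spinVal (z.1 j) - J' i j * spinVal (z.2 j)
        = J' i j * (spinVal (z.1 j) - spinVal (z.2 j)) + (J i j - J' i j) * spinVal (z.1 j) := by
      ring
    rw [e]
    refine (abs_add_le _ _).trans ?_
    rw [abs_mul, abs_mul, abs_spinVal, mul_one, mul_left_comm]
    gcongr
    by_cases h : z.1 j = z.2 j
    · simp only [h, sub_self, abs_zero]
      exact mul_nonneg zero_le_two (Set.indicator_nonneg (fun _ _ => zero_le_one) _)
    · rw [Set.indicator_of_mem (show z ∈ disagree j from h)]
      refine (abs_sub _ _).trans ?_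
      rw [abs_spinVal, abs_spinVal]
      norm_num
  have hsum := (hs1.mul_left 2).add hs2
  have hfield : |localField J i z.1 - localField J' i z.2|
      ≤ 2 * ∑' j, |J' i j| * (disagree j).indicator 1 z + ∑' j, |J i j - J' i j| := by
    rw [localField, localField,
      ← (summable_localField hJ i z.1).tsum_sub (summable_localField hJ' i z.2),
      ← tsum_mul_left, ← (hs1.mul_left 2).tsum_add hs2]
    exact tsum_of_norm_bounded (f := fun j => J i j * spinVal (z.1 j) - J' i j * spinVal (z.2 j))
      hsum.hasSum hterm
  rw [localSpec_eq, localSpec_eq]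
  refine (abs_sigmoid_sub_le _ _).trans ?_
  rw [← mul_sub, abs_mul]
  have h0 : 0 ≤ ∑' j, |J i j - J' i j| := tsum_nonneg fun j => abs_nonneg _
  simp only [spinVal, Units.val_one, Int.cast_one, mul_one, abs_two]
  linarith

/-- Integrating the pointwise bound turns each disagreement indicator into a probability, at most
`c`, weighted by `|J' i j|`. -/
theorem coupledGlauber_disagree_self_le (hJ : IsPairwisePotential J) (hJ' : IsPairwisePotential J')
    (i : Site d) {r c δ : ℝ} (hr : ∑' j, |J' i j| ≤ r) (hδ : ∑' j, |J i j - J' i j| ≤ δ)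
    (hr0 : 0 ≤ r) (hc : 0 ≤ c) (hδ0 : 0 ≤ δ)
    (π : Measure (Config d × Config d)) [IsProbabilityMeasure π]
    (hπ : ∀ j, π (disagree j) ≤ ENNReal.ofReal c) :
    coupledGlauber J J' i π (disagree i) ≤ ENNReal.ofReal (r * c + δ) := by
  have hpt : ∀ z : Config d × Config d,
      ENNReal.ofReal |localSpec J i 1 z.1 - localSpec J' i 1 z.2|
        ≤ ∑' j, ENNReal.ofReal |J' i j| * (disagree j).indicator 1 z + ENNReal.ofReal δ := fun z => by
    have hs : Summable fun j => |J' i j| * (disagree j).indicator (1 : Config d × Config d → ℝ) z :=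
      (hJ'.summable i).of_nonneg_of_le
        (fun j => mul_nonneg (abs_nonneg _) (Set.indicator_nonneg (fun _ _ => zero_le_one) _))
        fun j => mul_le_of_le_one_right (abs_nonneg _)
          (Set.indicator_le_self' (fun _ _ => zero_le_one) _)
    have h0 : ∀ j, 0 ≤ |J' i j| * (disagree j).indicator (1 : Config d × Config d → ℝ) z := fun j =>
      mul_nonneg (abs_nonneg _) (Set.indicator_nonneg (fun _ _ => zero_le_one) _)
    refine (ENNReal.ofReal_le_ofReal ((abs_localSpec_sub_le hJ hJ' i z).trans
      (add_le_add_right hδ _))).trans ?_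
    rw [ENNReal.ofReal_add (tsum_nonneg h0) hδ0, ENNReal.ofReal_tsum_of_nonneg h0 hs]
    gcongr with j
    rw [ENNReal.ofReal_mul (abs_nonneg _)]
    by_cases h : z ∈ disagree j <;> simp [h]
  rw [coupledGlauber_disagree_self hJ hJ']
  refine (lintegral_mono hpt).trans ?_
  have hm : ∀ j, Measurable fun z => ENNReal.ofReal |J' i j|
      * (disagree j).indicator (1 : Config d × Config d → ℝ≥0∞) z := fun j =>
    (measurable_one.indicator (measurableSet_disagree j)).const_mul _
  rw [lintegral_add_right _ measurable_const, lintegral_const, measure_univ, mul_one,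
    lintegral_tsum fun j => (hm j).aemeasurable, ENNReal.ofReal_add (by positivity) hδ0,
    ENNReal.ofReal_mul hr0]
  gcongr
  calc ∑' j, ∫⁻ z, ENNReal.ofReal |J' i j|
        * (disagree j).indicator (1 : Config d × Config d → ℝ≥0∞) z ∂π
      ≤ ∑' j, ENNReal.ofReal |J' i j| * ENNReal.ofReal c := by
        refine ENNReal.tsum_le_tsum fun j => ?_
        rw [lintegral_const_mul _ (measurable_one.indicator (measurableSet_disagree j)),
          lintegral_indicator_one (measurableSet_disagree j)]
        gcongr
        exact hπ j
    _ ≤ _ := by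
        rw [ENNReal.tsum_mul_right, ← ENNReal.ofReal_tsum_of_nonneg (fun _ => abs_nonneg _)
          (hJ'.summable i)]
        gcongr

/-- `π` is the law of a pair of configurations with marginal laws `μ` and `ν`. -/
structure IsJoining (μ ν : Measure (Config d)) (π : Measure (Config d × Config d)) : Prop where
  prob : IsProbabilityMeasure π
  fst : π.map Prod.fst = μ
  snd : π.map Prod.snd = ν

variable {μ ν : Measure (Config d)}

theorem IsJoining.coupledGlauber (hJ : IsPairwisePotential J) (hJ' : IsPairwisePotential J')
    {i : Site d} (hμ : glauber J i μ = μ) (hν : glauber J' i ν = ν)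
    {π : Measure (Config d × Config d)} (h : IsJoining μ ν π) :
    IsJoining μ ν (coupledGlauber J J' i π) where
  prob := by
    have := h.prob
    refine isProbabilityMeasure_mixMap (measurable_coupledGlauber_weight hJ hJ' i)
      (measurable_update_pair i) (fun z => ?_) π
    simp only [Fintype.sum_prod_type, sum_ofReal_weight_right, sum_ofReal_localSpec]
  fst := by rw [map_fst_coupledGlauber hJ hJ', h.fst, hμ]
  snd := by rw [map_snd_coupledGlauber hJ hJ', h.snd, hν]

/-- Joinings of two given laws form a compact set. -/
theorem exists_joining_limit [IsProbabilityMeasure μ] [IsProbabilityMeasure ν] {κ : Type*}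
    (l : Filter κ) [l.NeBot] {π : κ → Measure (Config d × Config d)}
    (hπ : ∀ n, IsJoining μ ν (π n)) :
    ∃ ρ, IsJoining μ ν ρ ∧ ∀ i (c : ℝ), 0 ≤ c → (∀ᶠ n in l, π n (disagree i) ≤ ENNReal.ofReal c) →
      ρ (disagree i) ≤ ENNReal.ofReal c := by
  have := fun n => (hπ n).prob
  obtain ⟨ρ, hρ, l', hl', hl0, hlim⟩ := exists_weak_limit l π
  have h1 := Measure.isProbabilityMeasure_map (μ := ρ) (measurable_fst (α := Config d)
    (β := Config d)).aemeasurable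
  have h2 := Measure.isProbabilityMeasure_map (μ := ρ) (measurable_snd (α := Config d)
    (β := Config d)).aemeasurable
  refine ⟨ρ, ⟨hρ, ?_, ?_⟩, fun i c hc hev => ?_⟩
  · refine measure_ext_of_continuousMap fun f => ?_
    rw [integral_map measurable_fst.aemeasurable f.continuous.aestronglyMeasurable]
    refine tendsto_nhds_unique (hlim (f.comp ⟨_, continuous_fst⟩)) (tendsto_const_nhds.congr fun n => ?_)
    rw [← (hπ n).fst, integral_map measurable_fst.aemeasurable f.continuous.aestronglyMeasurable]
    rfl
  · refine measure_ext_of_continuousMap fun f => ?_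
    rw [integral_map measurable_snd.aemeasurable f.continuous.aestronglyMeasurable]
    refine tendsto_nhds_unique (hlim (f.comp ⟨_, continuous_snd⟩)) (tendsto_const_nhds.congr fun n => ?_)
    rw [← (hπ n).snd, integral_map measurable_snd.aemeasurable f.continuous.aestronglyMeasurable]
    rfl
  · have hf := hlim ⟨(disagree i).indicator 1, (isClopen_disagree i).continuous_indicator
      continuous_one⟩
    simp only [ContinuousMap.coe_mk, integral_indicator_one (measurableSet_disagree i)] at hf
    rw [← ofReal_measureReal]
    refine ENNReal.ofReal_le_ofReal (le_of_tendsto hf (hl' ?_))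
    filter_upwards [hev] with n hn
    exact ENNReal.toReal_le_of_le_ofReal hc hn

theorem exists_joining_step (hJ : IsPairwisePotential J) (hJ' : IsPairwisePotential J')
    [IsProbabilityMeasure μ] [IsProbabilityMeasure ν]
    (hμ : ∀ i, glauber J i μ = μ) (hν : ∀ i, glauber J' i ν = ν) {r c δ : ℝ}
    (hr : ∀ i, ∑' j, |J' i j| ≤ r) (hδ : ∀ i, ∑' j, |J i j - J' i j| ≤ δ)
    (hr0 : 0 ≤ r) (hc : 0 ≤ c) (hδ0 : 0 ≤ δ) (hle : r * c + δ ≤ c)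
    (h : ∃ π, IsJoining μ ν π ∧ ∀ i, π (disagree i) ≤ ENNReal.ofReal c) :
    ∃ π, IsJoining μ ν π ∧ ∀ i, π (disagree i) ≤ ENNReal.ofReal (r * c + δ) := by
  -- The bound `c` at all sites is carried along because each new update needs it; `hle` keeps it
  -- valid at the updated site. Sites already improved are not spoiled by later updates elsewhere.
  have hsweep : ∀ Λ : Finset (Site d), ∃ π, IsJoining μ ν π ∧
      (∀ i, π (disagree i) ≤ ENNReal.ofReal c) ∧
      ∀ i ∈ Λ, π (disagree i) ≤ ENNReal.ofReal (r * c + δ) := fun Λ => by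
    induction Λ using Finset.induction_on with
    | empty =>
      obtain ⟨π, hπ, hb⟩ := h
      exact ⟨π, hπ, hb, by simp⟩
    | insert i Λ _ ih =>
      obtain ⟨π, hπ, hb, hΛ⟩ := ih
      have := hπ.prob
      have hi := coupledGlauber_disagree_self_le hJ hJ' i (hr i) (hδ i) hr0 hc hδ0 π hb
      refine ⟨_, hπ.coupledGlauber hJ hJ' (hμ i) (hν i), fun j => ?_, fun j hj => ?_⟩
      · by_cases hji : j = i
        · subst hji; exact hi.trans (ENNReal.ofReal_le_ofReal hle)
        · rw [coupledGlauber_disagree_of_ne hJ hJ' hji]; exact hb j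
      · by_cases hji : j = i
        · subst hji; exact hi
        · rw [coupledGlauber_disagree_of_ne hJ hJ' hji]
          exact hΛ j (Finset.mem_of_mem_insert_of_ne hj hji)
  choose π hπ _ hΛ using hsweep
  obtain ⟨ρ, hρ, hlim⟩ := exists_joining_limit atTop hπ
  refine ⟨ρ, hρ, fun i => hlim i _ (by positivity) ?_⟩
  filter_upwards [eventually_ge_atTop {i}] with Λ hi
  exact hΛ Λ i (hi (Finset.mem_singleton_self i))

/-- Under Dobrushin's condition, two Ising laws have a joining whose disagreement probabilities are
bounded, uniformly in the site, by the distance between the potentials. -/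
theorem exists_joining_disagree_le (hJ : IsPairwisePotential J) (hJ' : IsPairwisePotential J')
    [IsProbabilityMeasure μ] [IsProbabilityMeasure ν]
    (hμ : IsIsingLaw J μ) (hν : IsIsingLaw J' ν) {r δ : ℝ}
    (hr : ∀ i, ∑' j, |J' i j| ≤ r) (hδ : ∀ i, ∑' j, |J i j - J' i j| ≤ δ)
    (hr0 : 0 ≤ r) (hr1 : r < 1) (hδ0 : 0 ≤ δ) :
    ∃ π, IsJoining μ ν π ∧ ∀ i, π (disagree i) ≤ ENNReal.ofReal (1 / (1 - r) * δ) := by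
  set C := 1 / (1 - r) * δ with hC
  have hr' : 0 < 1 - r := sub_pos.2 hr1
  have hC0 : 0 ≤ C := by positivity
  -- `C` is the fixed point of `c ↦ r * c + δ`, so the excess over `C` shrinks by the factor `r` at
  -- each step.
  have hfix : r * C + δ = C := by rw [hC]; field_simp; ring
  have hiter : ∀ n : ℕ, ∃ π, IsJoining μ ν π ∧ ∀ i, π (disagree i) ≤ ENNReal.ofReal (C + r ^ n) := by
    intro n
    induction n with
    | zero =>
      -- The independent joining starts the iteration: the bound `C + 1` exceeds any probability.
      refine ⟨μ.prod ν, ⟨inferInstance, by simp, by simp⟩, fun i => prob_le_one.trans ?_⟩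
      rw [← ENNReal.ofReal_one]
      exact ENNReal.ofReal_le_ofReal (by simpa using hC0)
    | succ n ih =>
      have e : r * (C + r ^ n) + δ = C + r ^ (n + 1) := by rw [pow_succ]; linarith
      rw [← e]
      refine exists_joining_step hJ hJ' ((isIsingLaw_iff_glauber hJ).1 hμ)
        ((isIsingLaw_iff_glauber hJ').1 hν) hr hδ hr0 (by positivity) hδ0 ?_ ih
      rw [e, pow_succ]
      exact add_le_add_right (mul_le_of_le_one_right (by positivity) hr1.le) _
  choose π hπ hb using hiter
  obtain ⟨ρ, hρ, hlim⟩ := exists_joining_limit atTop hπ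
  have := hρ.prob
  refine ⟨ρ, hρ, fun i => ?_⟩
  rw [← ofReal_measureReal]
  refine ENNReal.ofReal_le_ofReal (le_of_forall_pos_le_add fun ε hε => ?_)
  refine ENNReal.toReal_le_of_le_ofReal (by positivity) (hlim i _ (by positivity) ?_)
  filter_upwards [(tendsto_pow_atTop_nhds_zero_of_lt_one hr0 hr1).eventually_le_const hε] with n hn
  exact (hb n i).trans (ENNReal.ofReal_le_ofReal (add_le_add_right hn _))

end Coupling

/-! ### The truncated potential and the conclusion. -/

theorem isPairwisePotential_truncPotential {d : ℕ} {J : Site d → Site d → ℝ}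
    (hJ : IsPairwisePotential J) (L : ℕ) : IsPairwisePotential (truncPotential L J) := by
  have hle : ∀ i j, |truncPotential L J i j| ≤ |J i j| := fun i j => by
    rw [truncPotential]; split_ifs <;> simp
  have hs : ∀ i, Summable fun j => |truncPotential L J i j| := fun i =>
    (hJ.summable i).of_nonneg_of_le (fun _ => abs_nonneg _) (hle i)
  refine ⟨fun i => by simp [truncPotential, hJ.diag], fun i j => ?_, hs, ?_⟩
  · simp only [truncPotential, siteBall, Set.mem_ofPred_eq, norm_sub_rev i j, hJ.symm i j]
    congr
  · obtain ⟨B, hB⟩ := hJ.bdd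
    refine ⟨B, ?_⟩
    rintro _ ⟨i, rfl⟩
    exact ((hs i).tsum_le_tsum (hle i) (hJ.summable i)).trans (hB ⟨i, rfl⟩)

theorem tsum_abs_sub_truncPotential {d : ℕ} (J : Site d → Site d → ℝ) (L : ℕ) (i : Site d) :
    ∑' j, |J i j - truncPotential L J i j| = ∑' j : ↥((siteBall L i)ᶜ), |J i j| := by
  rw [tsum_subtype ((siteBall L i)ᶜ) fun j => |J i j|]
  refine tsum_congr fun j => ?_
  by_cases h : j ∈ siteBall L i <;> simp [truncPotential, h]

theorem mainTheorem3 {d : ℕ} (L : ℕ) (hL : 1 ≤ L) (J : Site d → Site d → ℝ)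
    (hJ : IsPairwisePotential J) (r : ℝ) (hr : ⨆ i : Site d, ∑' j : Site d, |J i j| = r)
    (hr1 : r < 1) :
    (∃ μ : Measure (Config d), IsProbabilityMeasure μ ∧ IsIsingLaw J μ) ∧
    (∃ ν : Measure (Config d), IsProbabilityMeasure ν ∧ IsIsingLaw (truncPotential L J) ν) ∧
    ∀ {Ω Ω' : Type*} [MeasurableSpace Ω] [MeasurableSpace Ω']
      (P : Measure Ω) (P' : Measure Ω') [IsProbabilityMeasure P] [IsProbabilityMeasure P']
      (X : Ω → Config d) (Y : Ω' → Config d),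
      IsIsingModel J P X → IsIsingModel (truncPotential L J) P' Y →
      ∃ (Ω₀ : Type) (_ : MeasurableSpace Ω₀) (Q : Measure Ω₀) (Z : Ω₀ → Config d × Config d),
        IsProbabilityMeasure Q ∧ IsCoupling P X P' Y Q Z ∧
        ∀ i : Site d, Q.real {ω | (Z ω).1 i ≠ (Z ω).2 i} ≤
          1 / (1 - r) * ⨆ k : Site d, ∑' j : ↥((siteBall L k)ᶜ), |J k j| := by
  have hJL := isPairwisePotential_truncPotential hJ L
  refine ⟨exists_isIsingLaw hJ, exists_isIsingLaw hJL, ?_⟩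
  intro Ω Ω' _ _ P P' _ _ X Y hX hY
  have := Measure.isProbabilityMeasure_map (μ := P) hX.1.aemeasurable
  have := Measure.isProbabilityMeasure_map (μ := P') hY.1.aemeasurable
  have hJr : ∀ i, ∑' j, |J i j| ≤ r := fun i => hr ▸ le_ciSup hJ.bdd i
  have hr0 : 0 ≤ r := (tsum_nonneg fun _ => abs_nonneg _).trans (hJr 0)
  have hJLr : ∀ i, ∑' j, |truncPotential L J i j| ≤ r := fun i =>
    ((hJL.summable i).tsum_le_tsum (fun j => by rw [truncPotential]; split_ifs <;> simp)
      (hJ.summable i)).trans (hJr i)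
  have hbdd : BddAbove (Set.range fun k : Site d => ∑' j : ↥((siteBall L k)ᶜ), |J k j|) := by
    refine ⟨r, ?_⟩
    rintro _ ⟨k, rfl⟩
    exact ((hJ.summable k).tsum_subtype_le _ _ fun _ => abs_nonneg _).trans (hJr k)
  -- Here `J'` is the truncated potential, whose row sums are also at most `r`, and `δ` is the
  -- supremum of the tails outside the balls.
  obtain ⟨π, hπ, hb⟩ := exists_joining_disagree_le hJ hJL hX.2 hY.2 hJLr
    (fun i => (tsum_abs_sub_truncPotential J L i).trans_le (le_ciSup hbdd i)) hr0 hr1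
    (Real.iSup_nonneg fun _ => tsum_nonneg fun _ => abs_nonneg _)
  refine ⟨Config d × Config d, inferInstance, π, id, hπ.prob, ⟨measurable_id, hπ.fst, hπ.snd⟩,
    fun i => ENNReal.toReal_le_of_le_ofReal ?_ (hb i)⟩
  exact mul_nonneg (one_div_nonneg.2 (sub_nonneg.2 hr1.le))
    (Real.iSup_nonneg fun _ => tsum_nonneg fun _ => abs_nonneg _)
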